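/- Let $T:[0,1)\to[0,1)$ be the Gauss map $T(x)=\frac1x-\lfloor\frac1x\rfloor$ for $x\neq0$, $T(0)=0$, and let $a_i(x)=\lfloor 1/T^{i-1}(x)\rfloor$ $(i\ge1)$ be the digits of the regular continued fraction expansion $x=[0;a_1,a_2,\dots]$ of $x\in[0,1)$ (for rational $x$, put $a_i(x)=0$ for those $i$ with $T^{i-1}(x)=0$). Let $\lambda$ denote Lebesgue measure and $\mathbb N=\{1,2,3,\dots\}$. **Theorem 2.1.** Let $\Lambda:\mathbb N\to\mathbb N$ be strictly increasing. Then for all $\varepsilon>0$, $$\lim_{n\to\infty}\lambda\left(\left\{x\in[0,1):\left|\frac{1}{n\log n}\sum_{i=1}^n a_{\Lambda(i)}(x)-\frac1{\log2}\right|>\varepsilon\right\}\right)=0,$$ i.e. $\frac1{n\log n}\sum_{i=1}^n a_{\Lambda(i)}$ converges to $\frac1{\log 2}$ in Lebesgue measure on $[0,1)$. -/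

import Mathlib

open MeasureTheory Filter Topology

noncomputable section

/-- The regular continued fraction (Gauss) map `T x = 1 / x - ⌊1 / x⌋` for `x ≠ 0`, and `T 0 = 0`. -/
def gaussMap (x : ℝ) : ℝ :=
  if x = 0 then 0 else 1 / x - ⌊1 / x⌋

/-- The `i`-th digit (`i = 1, 2, …`) of the regular continued fraction expansion
`x = [0; a₁, a₂, …]` of `x ∈ [0, 1)`: `aᵢ(x) = ⌊1 / T^(i-1) x⌋`.
If `x` is rational, then `T^(i-1) x = 0` once the finite expansion is exhausted, and the digit
has the value `0` from there on (a set of Lebesgue measure zero). Only indices `i ≥ 1` are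
meaningful. -/
def cfDigit (i : ℕ) (x : ℝ) : ℕ :=
  ⌊1 / (gaussMap^[i - 1] x)⌋₊

end

/-!
The digits have infinite mean, so the weak law is proved by truncation and Chebyshev's inequality
with respect to the Gauss measure `μ`, of density `1 / ((1 + x) log 2)`, which dominates Lebesgue
measure on `[0, 1)` up to the constant `2 log 2`.

**Mixing.** Let `P` be the transfer operator of the Gauss map `T` with respect to `μ`
(`gaussTransfer`), so that `∫ f · (g ∘ T) dμ = ∫ P f · g dμ` (`integral_mul_comp_gaussMap`). The
probability weights in `P f y = ∑ₐ wₐ(y) f(1 / (a + 1 + y))` have the tails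
`∑_{b ≥ a} w_b(y) = (1 + y) / (a + 1 + y)`, which increase with `y`. Hence `P` turns antitone
functions into monotone ones and conversely, and for such functions the oscillation of `P f` is
`|P f 1 - P f 0|`. The values at the endpoints are related by `2 P f 0 = f 1 + P f 1`, so that `P`
halves the oscillation (`MonotoneOsc.monotoneOsc_gaussTransfer`). Iterating gives, for `g ≥ 0`,
`|∫ f · (g ∘ T^k) dμ - ∫ f dμ ∫ g dμ| ≤ 2⁻ᵏ (osc f) ∫ g dμ`
(`MonotoneOsc.abs_integral_mul_comp_iterate_sub_le`).

**Truncation.** The function `h = min(a₁, N)` (`truncDigit`) is antitone with oscillation at most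
`N`. The identity `μ(a₁ ≥ k) = log(1 + 1/k) / log 2` makes its mean telescope to
`log(N + 1) / log 2`. As `Λ` is strictly increasing, `|Λ i - Λ j| ≥ |i - j|`, and the covariances
of the `h ∘ T^(Λ i - 1)`, `1 ≤ i ≤ n`, sum to at most `4 n N log(N + 1) / log 2`
(`variance_sum_truncDigit_le`).

**Conclusion.** For a fixed `K`, take `N = K n`. The truncation changes some of the `n` digits with
probability at most `1 / (K log 2)`, the truncated sum has mean asymptotic to `n log n / log 2`,
and its variance is `O(n² log n) = o((n log n)²)`. Since `K` is arbitrary, the theorem follows.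
-/

noncomputable section

/-! ### The transfer operator contracts oscillations of monotone functions -/

/-- The conditional probability, under the Gauss measure, that a point lies on the branch of index
`a` of the Gauss map (where the first digit is `a + 1`), given that its image is `y`. -/
def gaussWeight (a : ℕ) (y : ℝ) : ℝ := (1 + y) / ((a + 1 + y) * (a + 2 + y))

/-- The transfer operator of the Gauss map with respect to the Gauss measure: the average of `f`
over the preimages `1 / (a + 1 + y)` of `y`. The branch with first digit `a + 1` has index `a`. -/
def gaussTransfer (f : ℝ → ℝ) (y : ℝ) : ℝ := ∑' a : ℕ, gaussWeight a y * f (1 / (a + 1 + y))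

theorem gaussWeight_nonneg (a : ℕ) {y : ℝ} (hy : 0 ≤ y) : 0 ≤ gaussWeight a y := by
  unfold gaussWeight; positivity

/-- The weights are the differences of the tails `∑_{b ≥ a} w_b(y) = (1 + y) / (a + 1 + y)`. -/
theorem gaussWeight_eq_sub (a : ℕ) {y : ℝ} (hy : 0 ≤ y) :
    gaussWeight a y = (1 + y) / (a + 1 + y) - (1 + y) / ((a + 1 : ℕ) + 1 + y) := by
  have h1 : (a : ℝ) + 1 + y ≠ 0 := by positivity
  have h2 : (a : ℝ) + 2 + y ≠ 0 := by positivity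
  have h3 : (a : ℝ) + 1 + 1 + y ≠ 0 := by positivity
  unfold gaussWeight
  push_cast
  field_simp
  ring

theorem tendsto_gaussTail (y : ℝ) :
    Tendsto (fun n : ℕ => (1 + y) / ((n : ℝ) + 1 + y)) atTop (𝓝 0) := by
  refine Tendsto.const_div_atTop ?_ _
  simpa only [add_assoc] using tendsto_atTop_add_const_right atTop (1 + y)
    tendsto_natCast_atTop_atTop

theorem hasSum_gaussWeight {y : ℝ} (hy : 0 ≤ y) : HasSum (fun a => gaussWeight a y) 1 := by
  rw [hasSum_iff_tendsto_nat_of_nonneg (fun a => gaussWeight_nonneg a hy)]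
  have h : ∀ n : ℕ, ∑ a ∈ Finset.range n, gaussWeight a y = 1 - (1 + y) / ((n : ℝ) + 1 + y) := by
    intro n
    rw [Finset.sum_congr rfl fun a _ => gaussWeight_eq_sub a hy,
      Finset.sum_range_sub' (fun a : ℕ => (1 + y) / ((a : ℝ) + 1 + y))]
    have : (1 : ℝ) + y ≠ 0 := by positivity
    simp [this]
  simp_rw [h]
  simpa using (tendsto_gaussTail y).const_sub 1

theorem one_div_branch_mem (a : ℕ) {y : ℝ} (hy : 0 ≤ y) :
    1 / ((a : ℝ) + 1 + y) ∈ Set.Ioc (0 : ℝ) 1 := by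
  constructor
  · positivity
  · rw [div_le_one (by positivity)]
    have : (0 : ℝ) ≤ a := Nat.cast_nonneg a
    linarith

theorem summable_gaussWeight_mul {F : ℕ → ℝ} {M y : ℝ} (hF : ∀ a, |F a| ≤ M) (hy : 0 ≤ y) :
    Summable fun a => gaussWeight a y * F a := by
  refine Summable.of_norm_bounded ((hasSum_gaussWeight hy).summable.mul_right M) fun a => ?_
  rw [norm_mul, Real.norm_of_nonneg (gaussWeight_nonneg a hy)]
  exact mul_le_mul_of_nonneg_left (hF a) (gaussWeight_nonneg a hy)

theorem gaussTransfer_neg (f : ℝ → ℝ) : gaussTransfer (-f) = -gaussTransfer f := by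
  ext y
  simp [gaussTransfer, tsum_neg]

/-- The weights at a larger point dominate stochastically those at a smaller one, because their
tails are larger. -/
theorem tsum_gaussWeight_mul_le {F : ℕ → ℝ} {M x y : ℝ} (hF : Monotone F) (hM : ∀ a, |F a| ≤ M)
    (hx : 0 ≤ x) (hxy : x ≤ y) :
    ∑' a, gaussWeight a x * F a ≤ ∑' a, gaussWeight a y * F a := by
  have hy := hx.trans hxy
  -- Summation by parts as an induction: the weight beyond `n` is lumped at the value `F n`.
  have key : ∀ n : ℕ,
      ∑ a ∈ Finset.range n, gaussWeight a x * F a + (1 + x) / ((n : ℝ) + 1 + x) * F n ≤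
        ∑ a ∈ Finset.range n, gaussWeight a y * F a + (1 + y) / ((n : ℝ) + 1 + y) * F n := by
    intro n
    induction n with
    | zero =>
      have h1 : (1 : ℝ) + x ≠ 0 := by positivity
      have h2 : (1 : ℝ) + y ≠ 0 := by positivity
      simp [h1, h2]
    | succ n ih =>
      rw [Finset.sum_range_succ, Finset.sum_range_succ, gaussWeight_eq_sub n hx,
        gaussWeight_eq_sub n hy]
      have htail : (1 + x) / (((n + 1 : ℕ) : ℝ) + 1 + x) ≤ (1 + y) / (((n + 1 : ℕ) : ℝ) + 1 + y) := by
        rw [div_le_div_iff₀ (by positivity) (by positivity)]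
        have : (0 : ℝ) ≤ (n + 1 : ℕ) := Nat.cast_nonneg _
        nlinarith
      nlinarith [hF (Nat.le_succ n)]
  have hlim : ∀ z, 0 ≤ z → Tendsto (fun n : ℕ => ∑ a ∈ Finset.range n, gaussWeight a z * F a +
      (1 + z) / ((n : ℝ) + 1 + z) * F n) atTop (𝓝 (∑' a, gaussWeight a z * F a)) := by
    intro z hz
    have h0 : Tendsto (fun n : ℕ => (1 + z) / ((n : ℝ) + 1 + z) * F n) atTop (𝓝 0) :=
      (tendsto_gaussTail z).zero_mul_isBoundedUnder_le
        (isBoundedUnder_of ⟨M, fun n => hM n⟩)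
    simpa using (summable_gaussWeight_mul hM hz).hasSum.tendsto_sum_nat.add h0
  exact le_of_tendsto_of_tendsto' (hlim x hx) (hlim y hy) key

theorem abs_le_of_osc {f : ℝ → ℝ} {v : ℝ}
    (hv : ∀ x ∈ Set.Ioc (0 : ℝ) 1, ∀ y ∈ Set.Ioc (0 : ℝ) 1, f x - f y ≤ v) {x : ℝ}
    (hx : x ∈ Set.Ioc (0 : ℝ) 1) : |f x| ≤ |f 1| + v := by
  have h1 : (1 : ℝ) ∈ Set.Ioc (0 : ℝ) 1 := by norm_num
  have := hv x hx 1 h1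
  have := hv 1 h1 x hx
  have := le_abs_self (f 1)
  have := neg_abs_le (f 1)
  rw [abs_le]
  constructor <;> linarith

theorem gaussTransfer_monotoneOn {f : ℝ → ℝ} {v : ℝ} (hf : AntitoneOn f (Set.Ioc 0 1))
    (hv : ∀ x ∈ Set.Ioc (0 : ℝ) 1, ∀ y ∈ Set.Ioc (0 : ℝ) 1, f x - f y ≤ v) :
    MonotoneOn (gaussTransfer f) (Set.Icc 0 1) := by
  intro x hx y hy hxy
  have hb : ∀ z, 0 ≤ z → ∀ a : ℕ, |f (1 / ((a : ℝ) + 1 + z))| ≤ |f 1| + v := fun z hz a =>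
    abs_le_of_osc hv (one_div_branch_mem a hz)
  calc gaussTransfer f x ≤ ∑' a : ℕ, gaussWeight a x * f (1 / (a + 1 + y)) := by
        refine Summable.tsum_le_tsum (fun a => ?_) (summable_gaussWeight_mul (hb x hx.1) hx.1)
          (summable_gaussWeight_mul (hb y hy.1) hx.1)
        refine mul_le_mul_of_nonneg_left ?_ (gaussWeight_nonneg a hx.1)
        refine hf (one_div_branch_mem a hy.1) (one_div_branch_mem a hx.1) ?_
        have := hx.1
        exact one_div_le_one_div_of_le (by positivity) (by linarith)
    _ ≤ gaussTransfer f y := by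
        refine tsum_gaussWeight_mul_le (fun a b hab => ?_) (hb y hy.1) hx.1 hxy
        refine hf (one_div_branch_mem b hy.1) (one_div_branch_mem a hy.1) ?_
        have := hy.1
        have : (a : ℝ) ≤ b := by exact_mod_cast hab
        exact one_div_le_one_div_of_le (by positivity) (by linarith)

/-- The weights satisfy `w_{a+1}(0) = w_a(1) / 2` and `w_0(0) = 1 / 2`, and the preimages of `0`
other than `1` are the preimages of `1`. So `P f 0 = (f 1 + P f 1) / 2`, whence
`P f 1 - P f 0 = (P f 1 - f 1) / 2`. -/
theorem gaussTransfer_one_sub_zero_le {f : ℝ → ℝ} {v : ℝ}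
    (hv : ∀ x ∈ Set.Ioc (0 : ℝ) 1, ∀ y ∈ Set.Ioc (0 : ℝ) 1, f x - f y ≤ v) :
    gaussTransfer f 1 - gaussTransfer f 0 ≤ v / 2 := by
  have hb : ∀ z, 0 ≤ z → ∀ a : ℕ, |f (1 / ((a : ℝ) + 1 + z))| ≤ |f 1| + v := fun z hz a =>
    abs_le_of_osc hv (one_div_branch_mem a hz)
  have h1 : (1 : ℝ) ∈ Set.Ioc (0 : ℝ) 1 := by norm_num
  have hw : ∀ a : ℕ, gaussWeight (a + 1) 0 = gaussWeight a 1 / 2 := by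
    intro a
    unfold gaussWeight
    push_cast
    field_simp
    ring
  have h0 : gaussTransfer f 0 = f 1 / 2 + gaussTransfer f 1 / 2 := by
    unfold gaussTransfer
    rw [(summable_gaussWeight_mul (hb 0 le_rfl) le_rfl).tsum_eq_zero_add, ← tsum_div_const]
    congr 1
    · norm_num [gaussWeight]
      ring
    · refine tsum_congr fun a => ?_
      rw [hw]
      push_cast
      ring_nf
  have h2 : gaussTransfer f 1 ≤ f 1 + v := by
    unfold gaussTransfer
    have hs := (hasSum_gaussWeight (zero_le_one' ℝ)).mul_right (f 1 + v)
    rw [one_mul] at hs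
    rw [← hs.tsum_eq]
    refine Summable.tsum_le_tsum (fun a => ?_) (summable_gaussWeight_mul (hb 1 zero_le_one)
      zero_le_one) hs.summable
    refine mul_le_mul_of_nonneg_left ?_ (gaussWeight_nonneg a zero_le_one)
    have := hv _ (one_div_branch_mem a zero_le_one) 1 h1
    linarith
  linarith

/-- `f` is monotone or antitone on `(0, 1]`, with oscillation at most `v` there. The point `0` is
left out, since `1 / 0 = 0` breaks the monotonicity of the digits there. -/
structure MonotoneOsc (f : ℝ → ℝ) (v : ℝ) : Prop where
  mono : MonotoneOn f (Set.Ioc 0 1) ∨ AntitoneOn f (Set.Ioc 0 1)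
  osc : ∀ x ∈ Set.Ioc (0 : ℝ) 1, ∀ y ∈ Set.Ioc (0 : ℝ) 1, f x - f y ≤ v

theorem MonotoneOsc.neg {f : ℝ → ℝ} {v : ℝ} (hf : MonotoneOsc f v) : MonotoneOsc (-f) v where
  mono := hf.mono.symm.imp (fun h => h.neg) (fun h => h.neg)
  osc x hx y hy := by
    have := hf.osc y hy x hx
    simp only [Pi.neg_apply]
    linarith

theorem MonotoneOsc.monotoneOsc_gaussTransfer_of_antitoneOn {f : ℝ → ℝ} {v : ℝ} (hf : MonotoneOsc f v)
    (ha : AntitoneOn f (Set.Ioc 0 1)) : MonotoneOsc (gaussTransfer f) (v / 2) := by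
  have hm := gaussTransfer_monotoneOn ha hf.osc
  refine ⟨Or.inl (hm.mono Set.Ioc_subset_Icc_self), fun x hx y hy => ?_⟩
  have h0 : (0 : ℝ) ∈ Set.Icc (0 : ℝ) 1 := by norm_num
  have h1 : (1 : ℝ) ∈ Set.Icc (0 : ℝ) 1 := by norm_num
  have := hm (Set.Ioc_subset_Icc_self hx) h1 hx.2
  have := hm h0 (Set.Ioc_subset_Icc_self hy) hy.1.le
  have := gaussTransfer_one_sub_zero_le hf.osc
  linarith

/-- The transfer operator halves the oscillation of monotone functions. -/
theorem MonotoneOsc.monotoneOsc_gaussTransfer {f : ℝ → ℝ} {v : ℝ} (hf : MonotoneOsc f v) :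
    MonotoneOsc (gaussTransfer f) (v / 2) := by
  rcases hf.mono with h | h
  · have := (hf.neg.monotoneOsc_gaussTransfer_of_antitoneOn h.neg).neg
    rwa [gaussTransfer_neg, neg_neg] at this
  · exact hf.monotoneOsc_gaussTransfer_of_antitoneOn h

/-! ### The Gauss measure and decay of correlations -/

theorem measurable_gaussMap : Measurable gaussMap := by
  unfold gaussMap
  refine Measurable.ite (measurableSet_singleton 0) measurable_const ?_
  have h : Measurable fun x : ℝ => 1 / x := by fun_prop
  exact h.sub (measurable_from_top.comp (Int.measurable_floor.comp h))

theorem gaussMap_branch (a : ℕ) {y : ℝ} (hy : y ∈ Set.Ico (0 : ℝ) 1) :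
    gaussMap (1 / (a + 1 + y)) = y := by
  have hpos : (0 : ℝ) < a + 1 + y := by have := hy.1; positivity
  have hfl : ⌊(a : ℝ) + 1 + y⌋ = (a : ℤ) + 1 := by
    rw [Int.floor_eq_iff]
    push_cast
    constructor <;> linarith [hy.1, hy.2]
  rw [gaussMap, if_neg (one_div_pos.2 hpos).ne', one_div_one_div, hfl]
  push_cast
  ring

theorem image_branch (a : ℕ) : (fun y : ℝ => 1 / ((a : ℝ) + 1 + y)) '' Set.Ico 0 1 =
    Set.Ioc (1 / (((a + 1 : ℕ) : ℝ) + 1)) (1 / ((a : ℝ) + 1)) := by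
  ext x
  push_cast
  constructor
  · rintro ⟨y, hy, rfl⟩
    have := hy.1
    exact ⟨one_div_lt_one_div_of_lt (by positivity) (by linarith [hy.2]),
      one_div_le_one_div_of_le (by positivity) (by linarith)⟩
  · rintro ⟨h1, h2⟩
    have hx : 0 < x := lt_trans (by positivity) h1
    rw [one_div_lt (by positivity) hx] at h1
    rw [le_one_div hx (by positivity)] at h2
    refine ⟨1 / x - a - 1, ⟨by linarith, by linarith⟩, ?_⟩
    simp

theorem pairwise_disjoint_image_branch : Pairwise (Function.onFun Disjoint fun a : ℕ =>
    (fun y : ℝ => 1 / ((a : ℝ) + 1 + y)) '' Set.Ico 0 1) := by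
  simp_rw [image_branch]
  have : Antitone fun n : ℕ => 1 / ((n : ℝ) + 1) := fun m n h => Nat.one_div_le_one_div h
  exact this.pairwise_disjoint_on_Ioc_succ

theorem iUnion_image_branch :
    ⋃ a : ℕ, (fun y : ℝ => 1 / ((a : ℝ) + 1 + y)) '' Set.Ico 0 1 = Set.Ioc 0 1 := by
  apply Set.Subset.antisymm
  · refine Set.iUnion_subset fun a => ?_
    rintro _ ⟨y, hy, rfl⟩
    exact one_div_branch_mem a hy.1
  · intro x hx
    have h1 : 1 ≤ 1 / x := by rw [le_div_iff₀ hx.1]; linarith [hx.2]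
    have h2 : 1 ≤ ⌊1 / x⌋₊ := Nat.le_floor (by simpa using h1)
    refine Set.mem_iUnion.2 ⟨⌊1 / x⌋₊ - 1, 1 / x - ⌊1 / x⌋₊, ⟨?_, ?_⟩, ?_⟩
    · exact sub_nonneg.2 (Nat.floor_le (by linarith))
    · linarith [Nat.lt_floor_add_one (1 / x)]
    · simp only [Nat.cast_sub h2, Nat.cast_one]
      rw [sub_add_cancel, add_sub_cancel, one_div_one_div]

theorem hasDerivWithinAt_branch (a : ℕ) {y : ℝ} (hy : y ∈ Set.Ico (0 : ℝ) 1) :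
    HasDerivWithinAt (fun y : ℝ => 1 / ((a : ℝ) + 1 + y)) (-1 / ((a : ℝ) + 1 + y) ^ 2)
      (Set.Ico 0 1) y := by
  have hpos : (a : ℝ) + 1 + y ≠ 0 := by have := hy.1; positivity
  simpa using (((hasDerivAt_id y).const_add ((a : ℝ) + 1)).fun_inv hpos).hasDerivWithinAt

theorem injOn_branch (a : ℕ) :
    Set.InjOn (fun y : ℝ => 1 / ((a : ℝ) + 1 + y)) (Set.Ico 0 1) := by
  intro x _ y _ h
  simpa using h

theorem abs_deriv_branch (a : ℕ) (y : ℝ) :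
    |-1 / ((a : ℝ) + 1 + y) ^ 2| = 1 / ((a : ℝ) + 1 + y) ^ 2 := by
  rw [neg_div, abs_neg, abs_of_nonneg (by positivity)]

/-- Change of variables on every branch of the Gauss map. -/
theorem hasSum_setIntegral_branch {F : ℝ → ℝ} (hF : IntegrableOn F (Set.Ioc 0 1)) :
    HasSum (fun a : ℕ => ∫ y in Set.Ico (0 : ℝ) 1,
      1 / ((a : ℝ) + 1 + y) ^ 2 * F (1 / (a + 1 + y))) (∫ x in Set.Ioc (0 : ℝ) 1, F x) := by
  rw [← iUnion_image_branch] at hF ⊢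
  have h := hasSum_integral_iUnion (fun a => by rw [image_branch]; exact measurableSet_Ioc)
    pairwise_disjoint_image_branch hF
  convert! h using 2 with a
  rw [integral_image_eq_integral_abs_deriv_smul measurableSet_Ico
    (fun y hy => hasDerivWithinAt_branch a hy) (injOn_branch a)]
  simp_rw [abs_deriv_branch, smul_eq_mul]

theorem integrableOn_branch {F : ℝ → ℝ} (hF : IntegrableOn F (Set.Ioc 0 1)) (a : ℕ) :
    IntegrableOn (fun y => 1 / ((a : ℝ) + 1 + y) ^ 2 * F (1 / (a + 1 + y))) (Set.Ico 0 1) := by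
  have h : IntegrableOn F ((fun y : ℝ => 1 / ((a : ℝ) + 1 + y)) '' Set.Ico 0 1) :=
    hF.mono_set (by rw [← iUnion_image_branch]; exact Set.subset_iUnion_of_subset a subset_rfl)
  rw [integrableOn_image_iff_integrableOn_abs_deriv_smul measurableSet_Ico
    (fun y hy => hasDerivWithinAt_branch a hy) (injOn_branch a)] at h
  simpa only [abs_deriv_branch, smul_eq_mul] using h

theorem setIntegral_eq_setIntegral_tsum_branch {F : ℝ → ℝ} (hF : IntegrableOn F (Set.Ioc 0 1)) :
    ∫ x in Set.Ioc (0 : ℝ) 1, F x = ∫ y in Set.Ioc (0 : ℝ) 1,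
      ∑' a : ℕ, 1 / ((a : ℝ) + 1 + y) ^ 2 * F (1 / (a + 1 + y)) := by
  rw [← integral_Ico_eq_integral_Ioc (f := fun y => ∑' a : ℕ, _),
    ← (hasSum_setIntegral_branch hF).tsum_eq]
  refine (hasSum_integral_of_summable_integral_norm (fun a => integrableOn_branch hF a) ?_).tsum_eq
  refine (hasSum_setIntegral_branch hF.norm).summable.congr fun a => ?_
  refine integral_congr_ae (Eventually.of_forall fun y => ?_)
  simp only [norm_mul]
  rw [Real.norm_of_nonneg (show 0 ≤ 1 / ((a : ℝ) + 1 + y) ^ 2 by positivity)]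

/-- The Gauss measure, of density `1 / ((1 + x) log 2)` on the unit interval. -/
def gaussMeasure : Measure ℝ :=
  (volume.restrict (Set.Ioc 0 1)).withDensity
    fun x => ENNReal.ofReal (1 / ((1 + x) * Real.log 2))

theorem integral_gaussMeasure (f : ℝ → ℝ) :
    ∫ x, f x ∂gaussMeasure = ∫ x in Set.Ioc (0 : ℝ) 1, 1 / ((1 + x) * Real.log 2) * f x := by
  rw [gaussMeasure, integral_withDensity_eq_integral_toReal_smul (by fun_prop)
    (Eventually.of_forall fun x => ENNReal.ofReal_lt_top)]
  refine setIntegral_congr_fun measurableSet_Ioc fun x hx => ?_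
  have := hx.1
  have := Real.log_pos one_lt_two
  simp only [smul_eq_mul]
  rw [ENNReal.toReal_ofReal (by positivity)]

theorem gaussMeasure_Ioc {t : ℝ} (h0 : 0 ≤ t) (h1 : t ≤ 1) :
    gaussMeasure (Set.Ioc 0 t) = ENNReal.ofReal (Real.log (1 + t) / Real.log 2) := by
  have hlog := Real.log_pos one_lt_two
  have hder : ∀ x ∈ Set.uIcc 0 t, HasDerivAt (fun x => Real.log (1 + x) / Real.log 2)
      (1 / ((1 + x) * Real.log 2)) x := by
    intro x hx
    rw [Set.uIcc_of_le h0] at hx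
    have hx0 : 1 + x ≠ 0 := by have := hx.1; positivity
    have := (((hasDerivAt_id x).const_add 1).log hx0).div_const (Real.log 2)
    simpa only [div_div, id] using this
  have hcont : ContinuousOn (fun x : ℝ => 1 / ((1 + x) * Real.log 2)) (Set.uIcc 0 t) := by
    rw [Set.uIcc_of_le h0]
    refine ContinuousOn.div continuousOn_const (by fun_prop) fun x hx => ?_
    have := hx.1
    positivity
  have hint := hcont.intervalIntegrable (μ := volume)
  rw [gaussMeasure, withDensity_apply _ measurableSet_Ioc, Measure.restrict_restrict measurableSet_Ioc,
    Set.inter_eq_left.2 (Set.Ioc_subset_Ioc_right h1), ← ofReal_integral_eq_lintegral_ofReal,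
    ← intervalIntegral.integral_of_le h0, intervalIntegral.integral_eq_sub_of_hasDerivAt hder hint]
  · simp
  · exact (intervalIntegrable_iff_integrableOn_Ioc_of_le h0).1 hint
  · filter_upwards [ae_restrict_mem measurableSet_Ioc] with x hx
    have := hx.1
    simp only [Pi.zero_apply]
    positivity

theorem gaussMeasure_compl_Ioc : gaussMeasure (Set.Ioc 0 1)ᶜ = 0 := by
  refine withDensity_absolutelyContinuous _ _ ?_
  simp [Measure.restrict_apply measurableSet_Ioc.compl]

theorem ae_gaussMeasure_mem : ∀ᵐ x ∂gaussMeasure, x ∈ Set.Ioc (0 : ℝ) 1 :=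
  gaussMeasure_compl_Ioc

instance : IsProbabilityMeasure gaussMeasure where
  measure_univ := by
    rw [← measure_add_measure_compl (measurableSet_Ioc (a := (0 : ℝ)) (b := 1)),
      gaussMeasure_compl_Ioc, gaussMeasure_Ioc zero_le_one le_rfl, one_add_one_eq_two,
      div_self (Real.log_pos one_lt_two).ne']
    simp

theorem MonotoneOsc.aestronglyMeasurable {f : ℝ → ℝ} {v : ℝ} (hf : MonotoneOsc f v) :
    AEStronglyMeasurable f gaussMeasure := by
  have h : AEMeasurable f (volume.restrict (Set.Ioc 0 1)) :=
    hf.mono.elim (aemeasurable_restrict_of_monotoneOn measurableSet_Ioc)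
      (aemeasurable_restrict_of_antitoneOn measurableSet_Ioc)
  exact (h.mono_ac (withDensity_absolutelyContinuous _ _)).aestronglyMeasurable

theorem MonotoneOsc.ae_norm_le {f : ℝ → ℝ} {v : ℝ} (hf : MonotoneOsc f v) :
    ∀ᵐ x ∂gaussMeasure, ‖f x‖ ≤ |f 1| + v := by
  filter_upwards [ae_gaussMeasure_mem] with x hx using abs_le_of_osc hf.osc hx

theorem MonotoneOsc.integrable {f : ℝ → ℝ} {v : ℝ} (hf : MonotoneOsc f v) :
    Integrable f gaussMeasure :=
  Integrable.of_bound hf.aestronglyMeasurable _ hf.ae_norm_le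

theorem integrable_gaussMeasure_iff {f : ℝ → ℝ} : Integrable f gaussMeasure ↔
    IntegrableOn (fun x => 1 / ((1 + x) * Real.log 2) * f x) (Set.Ioc 0 1) := by
  rw [gaussMeasure, integrable_withDensity_iff_integrable_smul' (by fun_prop)
    (Eventually.of_forall fun x => ENNReal.ofReal_lt_top)]
  refine integrableOn_congr_fun (fun x hx => ?_) measurableSet_Ioc
  have := hx.1
  have := Real.log_pos one_lt_two
  simp only [smul_eq_mul]
  rw [ENNReal.toReal_ofReal (by positivity)]

/-- Duality: `gaussTransfer` is adjoint to composition with the Gauss map. -/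
theorem integral_mul_comp_gaussMap {f g : ℝ → ℝ}
    (h : Integrable (fun x => f x * g (gaussMap x)) gaussMeasure) :
    ∫ x, f x * g (gaussMap x) ∂gaussMeasure = ∫ y, gaussTransfer f y * g y ∂gaussMeasure := by
  rw [integral_gaussMeasure, integral_gaussMeasure,
    setIntegral_eq_setIntegral_tsum_branch (integrable_gaussMeasure_iff.1 h),
    ← integral_Ico_eq_integral_Ioc, ← integral_Ico_eq_integral_Ioc]
  refine setIntegral_congr_fun measurableSet_Ico fun y hy => ?_
  rw [gaussTransfer, ← tsum_mul_right, ← tsum_mul_left]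
  refine tsum_congr fun a => ?_
  rw [gaussMap_branch a hy, gaussWeight]
  have hy0 := hy.1
  have h1 : (a : ℝ) + 1 + y ≠ 0 := by positivity
  have h2 : (a : ℝ) + 2 + y ≠ 0 := by positivity
  have h3 : (1 : ℝ) + y ≠ 0 := by positivity
  have h4 : (a : ℝ) + 1 + y + 1 ≠ 0 := by positivity
  have h5 : Real.log 2 ≠ 0 := (Real.log_pos one_lt_two).ne'
  have h6 : 1 + 1 / ((a : ℝ) + 1 + y) = (a + 2 + y) / (a + 1 + y) := by
    field_simp
    ring
  rw [h6]
  field_simp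

theorem gaussTransfer_one {y : ℝ} (hy : 0 ≤ y) : gaussTransfer (fun _ => 1) y = 1 := by
  simpa [gaussTransfer] using (hasSum_gaussWeight hy).tsum_eq

/-- Invariance of the Gauss measure: by duality it comes from `gaussTransfer` fixing the constant
function `1`. -/
theorem measurePreserving_gaussMap : MeasurePreserving gaussMap gaussMeasure gaussMeasure := by
  refine ⟨measurable_gaussMap, Measure.ext fun s hs => ?_⟩
  rw [Measure.map_apply measurable_gaussMap hs, ← ENNReal.toReal_eq_toReal_iff' (by simp) (by simp)]
  have hm : Measurable (s.indicator fun _ => (1 : ℝ)) := measurable_const.indicator hs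
  have hb : ∀ x, ‖s.indicator (fun _ => (1 : ℝ)) x‖ ≤ 1 := fun x =>
    (norm_indicator_le_norm_self _ _).trans (by simp)
  have h := integral_mul_comp_gaussMap (f := fun _ => 1) (g := s.indicator fun _ => 1)
    (Integrable.of_bound (by simpa only [one_mul, Function.comp_def] using
        (hm.comp measurable_gaussMap).aestronglyMeasurable) 1
      (Eventually.of_forall fun x => by simpa using hb (gaussMap x)))
  simp only [one_mul] at h
  rw [show (fun x => s.indicator (fun _ => (1 : ℝ)) (gaussMap x)) =
    (gaussMap ⁻¹' s).indicator fun _ => 1 from rfl] at h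
  have h' : ∫ y, gaussTransfer (fun _ => 1) y * s.indicator (fun _ => (1 : ℝ)) y ∂gaussMeasure =
      ∫ y, s.indicator (fun _ => (1 : ℝ)) y ∂gaussMeasure := by
    refine integral_congr_ae ?_
    filter_upwards [ae_gaussMeasure_mem] with y hy
    rw [gaussTransfer_one hy.1.le, one_mul]
  rw [h', integral_indicator_const _ (measurable_gaussMap hs), integral_indicator_const _ hs] at h
  simpa [Measure.real] using h

theorem MonotoneOsc.integral_gaussTransfer {f : ℝ → ℝ} {v : ℝ} (hf : MonotoneOsc f v) :
    ∫ y, gaussTransfer f y ∂gaussMeasure = ∫ x, f x ∂gaussMeasure := by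
  have h := integral_mul_comp_gaussMap (f := f) (g := fun _ => 1) (by simpa using hf.integrable)
  simpa using h.symm

theorem MonotoneOsc.abs_sub_integral_le {f : ℝ → ℝ} {v : ℝ} (hf : MonotoneOsc f v) {x : ℝ}
    (hx : x ∈ Set.Ioc (0 : ℝ) 1) : |f x - ∫ y, f y ∂gaussMeasure| ≤ v := by
  have h1 : ∫ y, f y ∂gaussMeasure ≤ f x + v := by
    have := integral_mono_ae hf.integrable (integrable_const (f x + v)) (by
      filter_upwards [ae_gaussMeasure_mem] with y hy
      linarith [hf.osc y hy x hx])
    simpa using this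
  have h2 : f x - v ≤ ∫ y, f y ∂gaussMeasure := by
    have := integral_mono_ae (integrable_const (f x - v)) hf.integrable (by
      filter_upwards [ae_gaussMeasure_mem] with y hy
      linarith [hf.osc x hx y hy])
    simpa using this
  rw [abs_le]
  constructor <;> linarith

/-- Exponential decay of correlations, at the rate at which `gaussTransfer` contracts the
oscillation. -/
theorem MonotoneOsc.abs_integral_mul_comp_iterate_sub_le {g : ℝ → ℝ}
    (hg : Integrable g gaussMeasure) (hg0 : ∀ x, 0 ≤ g x) (k : ℕ) :
    ∀ {f : ℝ → ℝ} {v : ℝ}, MonotoneOsc f v →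
    |∫ x, f x * g (gaussMap^[k] x) ∂gaussMeasure -
      (∫ x, f x ∂gaussMeasure) * ∫ x, g x ∂gaussMeasure| ≤
      v * (1 / 2) ^ k * ∫ x, g x ∂gaussMeasure := by
  induction k with
  | zero =>
    intro f v hf
    have hfg : Integrable (fun x => f x * g x) gaussMeasure :=
      hg.bdd_mul hf.aestronglyMeasurable hf.ae_norm_le
    simp only [Function.iterate_zero, id, pow_zero, mul_one]
    rw [← integral_const_mul, ← integral_const_mul, ← integral_sub hfg (hg.const_mul _)]
    refine norm_integral_le_of_norm_le (G := ℝ) (hg.const_mul v) ?_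
    filter_upwards [ae_gaussMeasure_mem] with x hx
    rw [← sub_mul, norm_mul, Real.norm_of_nonneg (hg0 x)]
    exact mul_le_mul_of_nonneg_right (hf.abs_sub_integral_le hx) (hg0 x)
  | succ k ih =>
    intro f v hf
    have hint : Integrable (fun x => f x * g (gaussMap^[k] (gaussMap x))) gaussMeasure :=
      Integrable.bdd_mul
        ((measurePreserving_gaussMap.iterate (k + 1)).integrable_comp_of_integrable hg)
        hf.aestronglyMeasurable hf.ae_norm_le
    have h := ih hf.monotoneOsc_gaussTransfer
    simp only [Function.iterate_succ, Function.comp_apply]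
    rw [integral_mul_comp_gaussMap (g := fun x => g (gaussMap^[k] x)) hint,
      ← hf.integral_gaussTransfer]
    refine h.trans_eq ?_
    ring

/-! ### Truncated digits -/

section

open ProbabilityTheory

/-- The first digit truncated at the level `N`, `min (a₁ x) N`, as a real number. Truncating by a
minimum, rather than by discarding large digits, keeps the function antitone on `(0, 1]`. -/
def truncDigit (N : ℕ) (x : ℝ) : ℝ := (min ⌊1 / x⌋₊ N : ℕ)

theorem le_floor_one_div_iff {k : ℕ} {x : ℝ} (hx : 0 < x) :
    k + 1 ≤ ⌊1 / x⌋₊ ↔ x ≤ 1 / (k + 1) := by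
  rw [Nat.le_floor_iff (by positivity), le_one_div hx (by positivity)]
  push_cast
  rfl

theorem measurable_truncDigit (N : ℕ) : Measurable (truncDigit N) := by
  have h : Measurable fun x : ℝ => min ⌊1 / x⌋₊ N :=
    (Nat.measurable_floor.comp (by fun_prop)).min measurable_const
  exact measurable_from_top.comp h

theorem truncDigit_nonneg (N : ℕ) (x : ℝ) : 0 ≤ truncDigit N x := Nat.cast_nonneg _

theorem truncDigit_le (N : ℕ) (x : ℝ) : truncDigit N x ≤ N :=
  Nat.cast_le.2 (min_le_right _ _)

theorem monotoneOsc_truncDigit (N : ℕ) : MonotoneOsc (truncDigit N) N where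
  mono := Or.inr fun x hx y _ hxy => by
    refine Nat.cast_le.2 (min_le_min_right _ (Nat.floor_mono ?_))
    exact one_div_le_one_div_of_le hx.1 hxy
  osc x _ y _ := by linarith [truncDigit_nonneg N y, truncDigit_le N x]

theorem memLp_truncDigit_comp (N k : ℕ) (p : ENNReal) :
    MemLp (fun x => truncDigit N (gaussMap^[k] x)) p gaussMeasure := by
  refine MemLp.of_bound ((measurable_truncDigit N).comp
    (measurable_gaussMap.iterate k)).aestronglyMeasurable N (Eventually.of_forall fun x => ?_)
  rw [Real.norm_of_nonneg (truncDigit_nonneg _ _)]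
  exact truncDigit_le _ _

theorem integral_comp_gaussMap_iterate {g : ℝ → ℝ} (hg : Measurable g) (k : ℕ) :
    ∫ x, g (gaussMap^[k] x) ∂gaussMeasure = ∫ x, g x ∂gaussMeasure := by
  have hT := measurePreserving_gaussMap.iterate k
  conv_rhs => rw [← hT.map_eq]
  rw [integral_map hT.measurable.aemeasurable hg.aestronglyMeasurable]

/-- Writing `min(a₁, N)` as the sum of the indicators of `a₁ ≥ k` for `1 ≤ k ≤ N`, the mean is the
telescoping sum of `log(1 + 1/k) / log 2`. -/
theorem integral_truncDigit (N : ℕ) :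
    ∫ x, truncDigit N x ∂gaussMeasure = Real.log (N + 1) / Real.log 2 := by
  have hae : truncDigit N =ᵐ[gaussMeasure] fun x =>
      ∑ k ∈ Finset.range N, (Set.Ioc (0 : ℝ) (1 / (k + 1))).indicator (fun _ => (1 : ℝ)) x := by
    filter_upwards [ae_gaussMeasure_mem] with x hx
    have : ∀ k : ℕ, (Set.Ioc (0 : ℝ) (1 / (k + 1))).indicator (fun _ => (1 : ℝ)) x =
        if k < ⌊1 / x⌋₊ then 1 else 0 := by
      intro k
      rw [Set.indicator_apply]
      refine if_congr ?_ rfl rfl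
      rw [← Nat.succ_le_iff, Nat.succ_eq_add_one, le_floor_one_div_iff hx.1]
      simp [hx.1]
    simp_rw [this]
    rw [Finset.sum_boole, truncDigit]
    congr 1
    rw [show (Finset.range N).filter (fun k => k < ⌊1 / x⌋₊) = Finset.range (min ⌊1 / x⌋₊ N) by
      ext k; simp [and_comm], Finset.card_range]
  have hterm : ∀ k : ℕ, ∫ x, (Set.Ioc (0 : ℝ) (1 / (k + 1))).indicator (fun _ => (1 : ℝ)) x
      ∂gaussMeasure = Real.log ((k + 1 : ℕ) + 1) / Real.log 2 - Real.log (k + 1) / Real.log 2 := by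
    intro k
    have hk : (0 : ℝ) < k + 1 := by positivity
    rw [integral_indicator_const _ measurableSet_Ioc, Measure.real, gaussMeasure_Ioc (by positivity)
      (by rw [div_le_one hk]; linarith [Nat.cast_nonneg (α := ℝ) k]), ENNReal.toReal_ofReal,
      ← sub_div, ← Real.log_div (by positivity) hk.ne', smul_eq_mul, mul_one]
    · congr 2
      push_cast
      field_simp
    · exact div_nonneg (Real.log_nonneg (by simp; positivity)) (Real.log_pos one_lt_two).le
  rw [integral_congr_ae hae, integral_finsetSum]
  · simp_rw [hterm]
    rw [Finset.sum_range_sub fun k : ℕ => Real.log ((k : ℝ) + 1) / Real.log 2]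
    simp
  · intro k _
    exact (integrable_const _).indicator measurableSet_Ioc

theorem covariance_truncDigit_le (N p k : ℕ) :
    cov[fun x => truncDigit N (gaussMap^[p] x), fun x => truncDigit N (gaussMap^[p + k] x);
      gaussMeasure] ≤ N * (1 / 2) ^ k * (Real.log (N + 1) / Real.log 2) := by
  rw [covariance_eq_sub (memLp_truncDigit_comp N p 2) (memLp_truncDigit_comp N (p + k) 2)]
  have hm := measurable_truncDigit N
  have h := (monotoneOsc_truncDigit N).abs_integral_mul_comp_iterate_sub_le
    (memLp_one_iff_integrable.1 (memLp_truncDigit_comp N 0 1)) (truncDigit_nonneg N) k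
  rw [integral_comp_gaussMap_iterate hm, integral_comp_gaussMap_iterate hm]
  have h2 := integral_comp_gaussMap_iterate
    (hm.mul (hm.comp (measurable_gaussMap.iterate k))) p
  simp only [Pi.mul_apply, Function.comp_apply, ← Function.iterate_add_apply] at h2
  simp only [Function.iterate_zero, id, integral_truncDigit] at h
  simp only [Pi.mul_def, integral_truncDigit, add_comm p k, h2]
  exact (le_abs_self _).trans h

theorem covariance_truncDigit_le_dist (N p q : ℕ) :
    cov[fun x => truncDigit N (gaussMap^[p] x), fun x => truncDigit N (gaussMap^[q] x);
      gaussMeasure] ≤ N * (1 / 2) ^ (Nat.dist p q) * (Real.log (N + 1) / Real.log 2) := by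
  rcases le_total p q with h | h
  · have := covariance_truncDigit_le N p (q - p)
    rwa [Nat.add_sub_cancel' h, ← Nat.dist_eq_sub_of_le h] at this
  · have := covariance_truncDigit_le N q (p - q)
    rwa [Nat.add_sub_cancel' h, ← Nat.dist_eq_sub_of_le h, Nat.dist_comm, covariance_comm] at this

theorem dist_le_dist_of_strictMono {Λ : ℕ → ℕ} (hΛ : StrictMono Λ) (i j : ℕ) :
    Nat.dist i j ≤ Nat.dist (Λ i) (Λ j) := by
  have key : ∀ i k : ℕ, Λ i + k ≤ Λ (i + k) := by
    intro i k
    induction k with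
    | zero => simp
    | succ k ih =>
      have := hΛ (Nat.lt_succ_self (i + k))
      rw [← add_assoc]
      exact Nat.succ_le_of_lt (ih.trans_lt this)
  rcases le_total i j with h | h
  · have := key i (j - i)
    rw [Nat.add_sub_cancel' h] at this
    rw [Nat.dist_eq_sub_of_le h, Nat.dist_eq_sub_of_le (hΛ.monotone h)]
    omega
  · have := key j (i - j)
    rw [Nat.add_sub_cancel' h] at this
    rw [Nat.dist_comm i, Nat.dist_comm (Λ i), Nat.dist_eq_sub_of_le h,
      Nat.dist_eq_sub_of_le (hΛ.monotone h)]
    omega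

theorem sum_half_pow_dist_le (i : ℕ) (s : Finset ℕ) :
    ∑ j ∈ s, (1 / 2 : ℝ) ^ Nat.dist i j ≤ 4 := by
  have hgeom : ∀ (t : Finset ℕ) (φ : ℕ → ℕ), Set.InjOn φ t → ∑ j ∈ t, (1 / 2 : ℝ) ^ φ j ≤ 2 := by
    intro t φ hφ
    rw [← Finset.sum_image (f := fun m => (1 / 2 : ℝ) ^ m) hφ]
    exact (summable_geometric_two.sum_le_tsum _ fun _ _ => by positivity).trans_eq
      tsum_geometric_two
  rw [← Finset.sum_filter_add_sum_filter_not s (fun j => i ≤ j)]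
  have h1 := hgeom (s.filter fun j => i ≤ j) (Nat.dist i) fun a ha b hb h => by
    simp only [Finset.coe_filter, Set.mem_ofPred_eq] at ha hb
    rw [Nat.dist_eq_sub_of_le ha.2, Nat.dist_eq_sub_of_le hb.2] at h
    omega
  have h2 := hgeom (s.filter fun j => ¬ i ≤ j) (Nat.dist i) fun a ha b hb h => by
    simp only [Finset.coe_filter, Set.mem_ofPred_eq, not_le] at ha hb
    rw [Nat.dist_eq_sub_of_le_right ha.2.le, Nat.dist_eq_sub_of_le_right hb.2.le] at h
    omega
  linarith

/-- The diagonal terms need no separate treatment: the decay of correlations with lag `0` bounds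
the variance of a truncated digit as well. -/
theorem variance_sum_truncDigit_le {Λ : ℕ → ℕ} (hΛ : StrictMono Λ) (N n : ℕ) :
    Var[fun x => ∑ i ∈ Finset.Icc 1 n, truncDigit N (gaussMap^[Λ i - 1] x); gaussMeasure] ≤
      4 * n * N * (Real.log (N + 1) / Real.log 2) := by
  rw [variance_fun_sum' fun i _ => memLp_truncDigit_comp N (Λ i - 1) 2]
  have hL : 0 ≤ Real.log (N + 1) / Real.log 2 :=
    div_nonneg (Real.log_nonneg (by simp)) (Real.log_pos one_lt_two).le
  have hrow : ∀ i ∈ Finset.Icc 1 n, ∑ j ∈ Finset.Icc 1 n,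
      cov[fun x => truncDigit N (gaussMap^[Λ i - 1] x), fun x => truncDigit N (gaussMap^[Λ j - 1] x);
        gaussMeasure] ≤ 4 * (N * (Real.log (N + 1) / Real.log 2)) := by
    intro i hi
    calc _ ≤ ∑ j ∈ Finset.Icc 1 n, (1 / 2 : ℝ) ^ Nat.dist i j *
          (N * (Real.log (N + 1) / Real.log 2)) := by
          refine Finset.sum_le_sum fun j hj => ?_
          refine (covariance_truncDigit_le_dist N _ _).trans ?_
          rw [mul_assoc, mul_left_comm]
          refine mul_le_mul_of_nonneg_right ?_ (by positivity)
          refine pow_le_pow_of_le_one (by norm_num) (by norm_num) ?_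
          have h1 := (Finset.mem_Icc.1 hi).1.trans (hΛ.le_apply (x := i))
          have h2 := (Finset.mem_Icc.1 hj).1.trans (hΛ.le_apply (x := j))
          have h3 := dist_le_dist_of_strictMono hΛ i j
          simp only [Nat.dist] at h3 ⊢
          omega
      _ ≤ _ := by
          rw [← Finset.sum_mul]
          exact mul_le_mul_of_nonneg_right (sum_half_pow_dist_le i _) (by positivity)
  refine (Finset.sum_le_sum hrow).trans_eq ?_
  simp
  ring

theorem gaussMeasure_lt_floor_le {N : ℕ} (hN : 0 < N) :
    gaussMeasure {x | N < ⌊1 / x⌋₊} ≤ ENNReal.ofReal (1 / (N * Real.log 2)) := by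
  have hlog := Real.log_pos one_lt_two
  have hsub : gaussMeasure {x | N < ⌊1 / x⌋₊} ≤ gaussMeasure (Set.Ioc 0 (1 / ((N : ℝ) + 1))) := by
    refine measure_mono_ae ?_
    filter_upwards [ae_gaussMeasure_mem] with x hx h
    exact ⟨hx.1, (le_floor_one_div_iff hx.1).1 h⟩
  refine hsub.trans ?_
  rw [gaussMeasure_Ioc (by positivity)
    (by rw [div_le_one (by positivity)]; linarith [Nat.cast_nonneg (α := ℝ) N])]
  refine ENNReal.ofReal_le_ofReal ?_
  have hN' : (0 : ℝ) < N := Nat.cast_pos.2 hN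
  rw [← div_div]
  refine div_le_div_of_nonneg_right ?_ hlog.le
  have h1 := Real.log_le_sub_one_of_pos (show 0 < 1 + 1 / ((N : ℝ) + 1) by positivity)
  have h2 : 1 / ((N : ℝ) + 1) ≤ 1 / N := one_div_le_one_div_of_le hN' (by linarith)
  linarith

theorem volume_Ico_inter_le_gaussMeasure (s : Set ℝ) :
    volume (Set.Ico 0 1 ∩ s) ≤ ENNReal.ofReal (2 * Real.log 2) * gaussMeasure s := by
  have hlog := Real.log_pos one_lt_two
  have h : volume.restrict (Set.Ioc (0 : ℝ) 1) ≤ ENNReal.ofReal (2 * Real.log 2) • gaussMeasure := by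
    rw [gaussMeasure, ← withDensity_smul _ (by fun_prop)]
    conv_lhs => rw [← withDensity_one (μ := volume.restrict (Set.Ioc (0 : ℝ) 1))]
    refine withDensity_mono ?_
    filter_upwards [ae_restrict_mem measurableSet_Ioc] with x hx
    have := hx.1
    rw [Pi.smul_apply, smul_eq_mul, ← ENNReal.ofReal_mul (by positivity), Pi.one_apply,
      ← ENNReal.ofReal_one]
    refine ENNReal.ofReal_le_ofReal ?_
    rw [mul_one_div, le_div_iff₀ (by positivity), one_mul]
    exact mul_le_mul_of_nonneg_right (by linarith [hx.2]) hlog.le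
  calc volume (Set.Ico 0 1 ∩ s) = volume.restrict (Set.Ioc (0 : ℝ) 1) s := by
        rw [← restrict_Ico_eq_restrict_Ioc, Set.inter_comm, Measure.restrict_apply' measurableSet_Ico]
    _ ≤ _ := by simpa using h s

theorem gaussMeasure_exists_lt_digit_le (Λ : ℕ → ℕ) {N : ℕ} (hN : 0 < N) (n : ℕ) :
    gaussMeasure {x | ∃ i ∈ Finset.Icc 1 n, N < cfDigit (Λ i) x} ≤
      ENNReal.ofReal (n / (N * Real.log 2)) := by
  have hms : MeasurableSet {x : ℝ | N < ⌊1 / x⌋₊} :=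
    measurableSet_lt measurable_const (Nat.measurable_floor.comp (by fun_prop))
  calc gaussMeasure {x | ∃ i ∈ Finset.Icc 1 n, N < cfDigit (Λ i) x}
      ≤ gaussMeasure (⋃ i ∈ Finset.Icc 1 n, gaussMap^[Λ i - 1] ⁻¹' {x | N < ⌊1 / x⌋₊}) := by
        refine measure_mono ?_
        rintro x ⟨i, hi, h⟩
        exact Set.mem_biUnion hi h
    _ ≤ ∑ i ∈ Finset.Icc 1 n, gaussMeasure (gaussMap^[Λ i - 1] ⁻¹' {x | N < ⌊1 / x⌋₊}) :=
        measure_biUnion_finset_le _ _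
    _ ≤ ∑ i ∈ Finset.Icc 1 n, ENNReal.ofReal (1 / (N * Real.log 2)) := by
        refine Finset.sum_le_sum fun i _ => ?_
        rw [(measurePreserving_gaussMap.iterate _).measure_preimage hms.nullMeasurableSet]
        exact gaussMeasure_lt_floor_le hN
    _ = _ := by
        simp only [Finset.sum_const, Nat.card_Icc, add_tsub_cancel_right, nsmul_eq_mul]
        rw [← ENNReal.ofReal_natCast, ← ENNReal.ofReal_mul (Nat.cast_nonneg n), mul_one_div]

/-! ### The weak law -/

theorem tendsto_log_mul_add_one_div_log (K : ℕ) (hK : 0 < K) :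
    Tendsto (fun n : ℕ => Real.log ((K * n : ℕ) + 1) / Real.log n) atTop (𝓝 1) := by
  have hlog : Tendsto (fun n : ℕ => Real.log n) atTop atTop :=
    Real.tendsto_log_atTop.comp tendsto_natCast_atTop_atTop
  have hup : Tendsto (fun n : ℕ => 1 + Real.log (K + 1) / Real.log n) atTop (𝓝 1) := by
    simpa using (hlog.const_div_atTop (Real.log (K + 1))).const_add 1
  refine tendsto_of_tendsto_of_tendsto_of_le_of_le' tendsto_const_nhds hup ?_ ?_
  all_goals
    filter_upwards [eventually_ge_atTop 2] with n hn
    have hn1 : (1 : ℝ) < n := by exact_mod_cast hn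
    have hlogn : 0 < Real.log n := Real.log_pos hn1
    have hK1 : (1 : ℝ) ≤ K := by exact_mod_cast hK
    push_cast
  · rw [le_div_iff₀ hlogn, one_mul]
    exact Real.log_le_log (by linarith) (by nlinarith)
  · rw [div_le_iff₀ hlogn, add_mul, one_mul, div_mul_cancel₀ _ hlogn.ne', add_comm (Real.log n),
      ← Real.log_mul (by positivity) (by positivity)]
    exact Real.log_le_log (by positivity) (by linarith)

theorem gaussMeasure_abs_sum_truncDigit_sub_le {Λ : ℕ → ℕ} (hΛ : StrictMono Λ) (N n : ℕ) {c : ℝ}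
    (hc : 0 < c) :
    gaussMeasure {x | c ≤ |∑ i ∈ Finset.Icc 1 n, truncDigit N (gaussMap^[Λ i - 1] x) -
        n * (Real.log (N + 1) / Real.log 2)|} ≤
      ENNReal.ofReal (4 * n * N * (Real.log (N + 1) / Real.log 2) / c ^ 2) := by
  have hmem : MemLp (fun x => ∑ i ∈ Finset.Icc 1 n, truncDigit N (gaussMap^[Λ i - 1] x)) 2
      gaussMeasure := memLp_finsetSum _ fun i _ => memLp_truncDigit_comp N (Λ i - 1) 2
  have hmean : ∫ x, ∑ i ∈ Finset.Icc 1 n, truncDigit N (gaussMap^[Λ i - 1] x) ∂gaussMeasure =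
      n * (Real.log (N + 1) / Real.log 2) := by
    rw [integral_finsetSum _ fun i _ =>
      memLp_one_iff_integrable.1 (memLp_truncDigit_comp N (Λ i - 1) 1)]
    simp_rw [integral_comp_gaussMap_iterate (measurable_truncDigit N), integral_truncDigit]
    simp
  have h := meas_ge_le_variance_div_sq hmem hc
  rw [hmean] at h
  exact h.trans (ENNReal.ofReal_le_ofReal
    (div_le_div_of_nonneg_right (variance_sum_truncDigit_le hΛ N n) (by positivity)))

end

end

theorem theorem2p1 (Λ : ℕ → ℕ) (hΛ : StrictMono Λ) (ε : ℝ) (hε : 0 < ε) :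
    Tendsto
      (fun n : ℕ => volume {x : ℝ | x ∈ Set.Ico (0 : ℝ) 1 ∧
        ε < |1 / ((n : ℝ) * Real.log n) * (∑ i ∈ Finset.Icc 1 n, (cfDigit (Λ i) x : ℝ))
              - 1 / Real.log 2|})
      atTop (𝓝 0) := by
  have hlog2 := Real.log_pos one_lt_two
  rw [ENNReal.tendsto_nhds_zero]
  intro δ hδ
  obtain ⟨δ', -, hδ0, hδ'⟩ := ENNReal.lt_iff_exists_real_btwn.1 hδ
  rw [ENNReal.ofReal_pos] at hδ0
  -- The truncation level is `K n`. It costs Lebesgue measure at most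
  -- `2 log 2 / (K log 2) = 2 / K < δ' / 2`.
  obtain ⟨K, hK⟩ := exists_nat_gt (4 / δ')
  have hK0 : (0 : ℝ) < K := lt_trans (by positivity) hK
  have hKpos : 0 < K := Nat.cast_pos.1 hK0
  have hratio := tendsto_log_mul_add_one_div_log K hKpos
  have hlog : Tendsto (fun n : ℕ => Real.log n) atTop atTop :=
    Real.tendsto_log_atTop.comp tendsto_natCast_atTop_atTop
  -- The normalized mean of the truncated sum is eventually within `ε / 2` of `1 / log 2`.
  have hmean : ∀ᶠ n : ℕ in atTop, |Real.log ((K * n : ℕ) + 1) / Real.log n - 1| <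
      ε / 2 * Real.log 2 := by
    have := hratio.sub_const 1
    rw [sub_self] at this
    have := this.abs
    rw [abs_zero] at this
    exact this.eventually_lt_const (by positivity)
  -- The Chebyshev bound at distance `(ε / 2) n log n`, with the factor `2 log 2` of the passage to
  -- Lebesgue measure.
  have hvar : ∀ᶠ n : ℕ in atTop, 2 * Real.log 2 * (16 * K / (ε ^ 2 * Real.log 2) *
      (Real.log ((K * n : ℕ) + 1) / Real.log n / Real.log n)) < δ' / 2 := by
    have := ((hratio.div_atTop hlog).const_mul (16 * K / (ε ^ 2 * Real.log 2))).const_mul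
      (2 * Real.log 2)
    rw [mul_zero, mul_zero] at this
    exact this.eventually_lt_const (by positivity)
  filter_upwards [hmean, hvar, eventually_ge_atTop 2] with n hn1 hn2 hn3
  have hn1' : (1 : ℝ) < n := by exact_mod_cast hn3
  have hn0 : (0 : ℝ) < n := by linarith
  have hlogn : 0 < Real.log n := Real.log_pos hn1'
  set N := K * n with hN
  have hNpos : 0 < N := Nat.mul_pos hKpos (by omega)
  set m := Real.log ((N : ℝ) + 1) / Real.log 2 with hm
  set A : Set ℝ := {x | ∃ i ∈ Finset.Icc 1 n, N < cfDigit (Λ i) x} with hA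
  set B : Set ℝ := {x | ε / 2 * (n * Real.log n) ≤
    |∑ i ∈ Finset.Icc 1 n, truncDigit N (gaussMap^[Λ i - 1] x) - n * m|} with hB
  -- `A`: some digit is changed by the truncation; `B`: the truncated sum is far from its mean.
  have hsub : {x : ℝ | x ∈ Set.Ico (0 : ℝ) 1 ∧
      ε < |1 / ((n : ℝ) * Real.log n) * (∑ i ∈ Finset.Icc 1 n, (cfDigit (Λ i) x : ℝ))
              - 1 / Real.log 2|} ⊆ Set.Ico 0 1 ∩ (A ∪ B) := by
    rintro x ⟨hx, hxε⟩
    refine ⟨hx, ?_⟩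
    by_contra hAB
    rw [Set.mem_union, not_or] at hAB
    have hxA : ∀ i ∈ Finset.Icc 1 n, cfDigit (Λ i) x ≤ N := fun i hi => by
      by_contra h
      exact hAB.1 ⟨i, hi, not_le.1 h⟩
    have hxB : |∑ i ∈ Finset.Icc 1 n, truncDigit N (gaussMap^[Λ i - 1] x) - n * m| <
        ε / 2 * (n * Real.log n) := lt_of_not_ge hAB.2
    have hsum : ∑ i ∈ Finset.Icc 1 n, truncDigit N (gaussMap^[Λ i - 1] x) =
        ∑ i ∈ Finset.Icc 1 n, (cfDigit (Λ i) x : ℝ) :=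
      Finset.sum_congr rfl fun i hi => by
        rw [truncDigit, ← cfDigit, min_eq_left (hxA i hi)]
    rw [hsum] at hxB
    set S := ∑ i ∈ Finset.Icc 1 n, (cfDigit (Λ i) x : ℝ)
    have hsplit : 1 / ((n : ℝ) * Real.log n) * S - 1 / Real.log 2 =
        (S - n * m) / (n * Real.log n) + (Real.log (N + 1) / Real.log n - 1) / Real.log 2 := by
      rw [hm]
      field_simp
      ring
    have h1 : |(S - n * m) / (n * Real.log n)| < ε / 2 := by
      rw [abs_div, abs_of_pos (show 0 < n * Real.log n by positivity),
        div_lt_iff₀ (by positivity)]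
      exact hxB
    have h2 : |(Real.log (N + 1) / Real.log n - 1) / Real.log 2| < ε / 2 := by
      rw [abs_div, abs_of_pos hlog2, div_lt_iff₀ hlog2]
      exact hn1
    rw [hsplit] at hxε
    linarith [abs_add_le ((S - n * m) / (n * Real.log n))
      ((Real.log (N + 1) / Real.log n - 1) / Real.log 2)]
  have hμA : gaussMeasure A ≤ ENNReal.ofReal (1 / (K * Real.log 2)) := by
    refine (gaussMeasure_exists_lt_digit_le Λ hNpos n).trans_eq ?_
    congr 1
    rw [hN]
    push_cast
    field_simp
  have hμB : gaussMeasure B ≤ ENNReal.ofReal (16 * K / (ε ^ 2 * Real.log 2) *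
      (Real.log (N + 1) / Real.log n / Real.log n)) := by
    refine (gaussMeasure_abs_sum_truncDigit_sub_le hΛ N n (by positivity)).trans_eq ?_
    congr 1
    rw [show (N : ℝ) = K * n by rw [hN]; push_cast; rfl]
    field_simp
    ring
  have hNlog : 0 ≤ Real.log ((N : ℝ) + 1) := Real.log_nonneg (by simp)
  calc _ ≤ volume (Set.Ico 0 1 ∩ (A ∪ B)) := measure_mono hsub
    _ ≤ ENNReal.ofReal (2 * Real.log 2) * (gaussMeasure A + gaussMeasure B) :=
        (volume_Ico_inter_le_gaussMeasure _).trans (mul_le_mul_right (measure_union_le _ _) _)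
    _ ≤ ENNReal.ofReal (2 * Real.log 2) * (ENNReal.ofReal (1 / (K * Real.log 2)) +
          ENNReal.ofReal (16 * K / (ε ^ 2 * Real.log 2) *
            (Real.log (N + 1) / Real.log n / Real.log n))) :=
        mul_le_mul_right (add_le_add hμA hμB) _
    _ = ENNReal.ofReal (2 / K + 2 * Real.log 2 * (16 * K / (ε ^ 2 * Real.log 2) *
          (Real.log (N + 1) / Real.log n / Real.log n))) := by
        rw [← ENNReal.ofReal_add (by positivity) (by positivity),
          ← ENNReal.ofReal_mul (by positivity), mul_add]
        congr 2
        field_simp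
    _ ≤ ENNReal.ofReal δ' := by
        refine ENNReal.ofReal_le_ofReal ?_
        have : 2 / (K : ℝ) < δ' / 2 := by
          rw [div_lt_iff₀ hδ0] at hK
          rw [div_lt_iff₀ hK0]
          linarith
        linarith
    _ ≤ δ := hδ'.le
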